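/- Let $n\ge 1$ and $[n]=\{1,\dots,n\}$. Write a permutation $\pi$ of $[n]$ in one-line notation as $\pi_1\pi_2\cdots\pi_n$. Call $\pi$ *cyclic* if it can be written in cycle notation as a single $n$-cycle (for $n=1$ the identity is cyclic), and *unimodal* if there is some $m$ with $1\le m\le n$ and $$\pi_1<\pi_2<\cdots<\pi_m>\pi_{m+1}>\cdots>\pi_n .$$ Let $\mathrm{des}(\pi)=|\{i : 1\le i\le n-1,\ \pi_i>\pi_{i+1}\}|$ be the number of descents of $\pi$, and let $\mathcal{C}_n$ be the set of cyclic permutations of $[n]$. Then $$\sum_{\substack{\pi\in\mathcal{C}_n\\ \pi\ \text{unimodal}}}(-1)^{\mathrm{des}(\pi)}=\mu(n),$$ where $\mu$ is the number-theoretic Möbius function: $\mu(n)=(-1)^t$ if $n$ is a product of $t\ge 0$ distinct primes, and $\mu(n)=0$ otherwise. -/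

import Mathlib

/-- A permutation of `[n]`, modelled as `Fin n` (so positions and values are shifted by one),
is cyclic if its cycle notation is a single `n`-cycle, fixed points being counted as `1`-cycles.
In particular the identity of a one-element set is cyclic. -/
def IsCyclicPerm {n : ℕ} (π : Equiv.Perm (Fin n)) : Prop :=
  π.IsCycleOn Set.univ

/-- A word `x₁ x₂ ⋯ xₙ` is unimodal if `x₁ < ⋯ < xₘ > ⋯ > xₙ` for some position `m`. -/
def IsUnimodalWord {n : ℕ} {α : Type*} [Preorder α] (x : Fin n → α) : Prop :=
  ∃ m : Fin n, StrictMonoOn x (Set.Iic m) ∧ StrictAntiOn x (Set.Ici m)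

/-- The descent set: the positions `i`, other than the last one, whose entry in the one-line
notation is larger than the next entry. -/
def descentSet {n : ℕ} (π : Equiv.Perm (Fin n)) : Finset (Fin n) :=
  {i | ∃ h : (i : ℕ) + 1 < n, π ⟨(i : ℕ) + 1, h⟩ < π i}

/-- The number of descents. -/
def des {n : ℕ} (π : Equiv.Perm (Fin n)) : ℕ :=
  (descentSet π).card

open Classical in
/-- The finite set of the cyclic permutations of `[n]` with unimodal one-line notation. -/
noncomputable def unimodalCyclicPerms (n : ℕ) : Finset (Equiv.Perm (Fin n)) :=
  {π | IsCyclicPerm π ∧ IsUnimodalWord (fun i => π i)}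

/-! Attach signs to the positions of a unimodal permutation: 1 on the rise, -1 on the fall. The peak
may take either sign, so there are two such words, with des and des + 1 letters -1. Marking a
position of sign -1 and weighting by the product of the signs gives des·(-1)^des +
(des+1)·(-1)^(des+1) = -(-1)^des (`sum_isAdapted`). A cyclic permutation with a marked point is a
labelling of `ZMod n`, so the signs become a circular word `w` with `w 0 = -1`, and the task is to
count the compatible labellings of each word. Compatibility forces a signed lexicographic order,
leaving freedom only between positions that differ by a period. If the minimal period p has sign s
and n = e·p, the count is 1 for e = 1, 2 for e = 2 and s = -1, and 0 otherwise. Möbius inversion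
writes sign times count as a sum over the d for which n/d is a period (`prod_mul_compatibleCount`).
After exchanging sums, a sign-reversing involution kills every d except d = n, which leaves -μ(n).
-/

/-- A word of signs `v` is adapted to `π` if its letters `1` precede its letters `-1`, and `π` is
increasing on the positions of the former and decreasing on those of the latter. -/
def IsAdapted {n : ℕ} (π : Equiv.Perm (Fin n)) (v : Fin n → ℤˣ) : Prop :=
  ∀ a b, a < b → v b ≤ v a ∧ (v a = 1 → v b = 1 → π a < π b) ∧ (v a = -1 → v b = -1 → π b < π a)

/-! ### Cyclic permutations with a marked point -/

/-- The rotation `a ↦ a + 1` of `ZMod n`, transported to `Fin n` by a labelling. -/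
def transportRotation {n : ℕ} (σ : ZMod n ≃ Fin n) : Equiv.Perm (Fin n) :=
  σ.symm.trans ((Equiv.addRight (1 : ZMod n)).trans σ)

theorem transportRotation_apply {n : ℕ} (σ : ZMod n ≃ Fin n) (a : ZMod n) :
    transportRotation σ (σ a) = σ (a + 1) := by
  simp [transportRotation]

theorem transportRotation_pow_apply {n : ℕ} (σ : ZMod n ≃ Fin n) (k : ℕ) (a : ZMod n) :
    (transportRotation σ ^ k) (σ a) = σ (a + k) := by
  induction k with
  | zero => simp
  | succ k ih => rw [pow_succ', Equiv.Perm.mul_apply, ih, transportRotation_apply]; congr 1; push_cast; ring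

theorem isCyclicPerm_transportRotation {n : ℕ} [NeZero n] (σ : ZMod n ≃ Fin n) :
    IsCyclicPerm (transportRotation σ) := by
  refine ⟨Set.bijOn_univ.2 (Equiv.bijective _), fun x _ y _ => ?_⟩
  obtain ⟨a, rfl⟩ := σ.surjective x
  obtain ⟨b, rfl⟩ := σ.surjective y
  refine ⟨((b - a).val : ℕ), ?_⟩
  rw [zpow_natCast, transportRotation_pow_apply]
  simp

theorem eq_of_transportRotation_eq {n : ℕ} [NeZero n] {σ τ : ZMod n ≃ Fin n}
    (h : transportRotation σ = transportRotation τ) (h0 : σ 0 = τ 0) : σ = τ := by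
  ext1 a
  have := transportRotation_pow_apply σ a.val 0
  rw [h, h0, transportRotation_pow_apply] at this
  simpa using this.symm

theorem exists_transportRotation_eq {n : ℕ} [NeZero n] {π : Equiv.Perm (Fin n)}
    (hπ : IsCyclicPerm π) (i : Fin n) :
    ∃ σ : ZMod n ≃ Fin n, transportRotation σ = π ∧ σ 0 = i := by
  have hc : π.IsCycleOn ((Finset.univ : Finset (Fin n)) : Set (Fin n)) := by
    simpa [IsCyclicPerm] using hπ
  have hmod : ∀ {k l : ℕ}, (k : ZMod n) = l → (π ^ k) i = (π ^ l) i := fun {k l} h => by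
    rw [hc.pow_apply_eq_pow_apply (Finset.mem_univ i), Finset.card_univ, Fintype.card_fin]
    exact (ZMod.natCast_eq_natCast_iff _ _ _).1 h
  have hs : Function.Surjective (fun a : ZMod n => (π ^ a.val) i) := fun y => by
    obtain ⟨k, -, hk⟩ := hc.exists_pow_eq (Finset.mem_univ i) (Finset.mem_univ y)
    exact ⟨k, (hmod (by simp)).trans hk⟩
  have hb : Function.Bijective (fun a : ZMod n => (π ^ a.val) i) :=
    (Fintype.bijective_iff_surjective_and_card _).2 ⟨hs, by simp [ZMod.card]⟩
  refine ⟨Equiv.ofBijective _ hb, ?_, by simp⟩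
  ext1 y
  obtain ⟨a, rfl⟩ := (Equiv.ofBijective _ hb).surjective y
  rw [transportRotation_apply]
  simp only [Equiv.ofBijective_apply]
  rw [← Equiv.Perm.mul_apply, ← pow_succ']
  exact hmod (by simp)

open Classical in
-- Following the cycle from the marked point `σ 0` recovers the labelling, so `σ` amounts to a
-- cyclic permutation with one marked point.
theorem sum_transportRotation {n : ℕ} [NeZero n] (F : Equiv.Perm (Fin n) → Fin n → ℤ) :
    ∑ σ : ZMod n ≃ Fin n, F (transportRotation σ) (σ 0) =
      ∑ π : Equiv.Perm (Fin n) with IsCyclicPerm π, ∑ i, F π i := by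
  rw [← Finset.sum_product']
  refine Finset.sum_nbij (fun σ => (transportRotation σ, σ 0)) ?_ ?_ ?_ ?_
  · intro σ _
    simp [isCyclicPerm_transportRotation]
  · intro σ _ τ _ h
    rw [Prod.mk.injEq] at h
    exact eq_of_transportRotation_eq h.1 h.2
  · rintro ⟨π, i⟩ h
    obtain ⟨σ, h1, h2⟩ := exists_transportRotation_eq (π := π) (by simpa using h) i
    exact ⟨σ, by simp, by simp [h1, h2]⟩
  · intros; rfl

/-! ### Sign words of unimodal permutations -/

/-- A unimodal permutation with peak `m` is adapted to exactly two words. -/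
theorem isAdapted_iff_of_unimodal {n : ℕ} {π : Equiv.Perm (Fin n)} {m : Fin n}
    (h1 : StrictMonoOn π (Set.Iic m)) (h2 : StrictAntiOn π (Set.Ici m)) (v : Fin n → ℤˣ) :
    IsAdapted π v ↔ v = (fun i => if i < m then 1 else -1) ∨ v = fun i => if i ≤ m then 1 else -1 := by
  have hlt : ∀ x y : ℤˣ, y ≤ x → x = -1 → y = -1 := by decide
  have hlt' : ∀ x y : ℤˣ, y ≤ x → y = 1 → x = 1 := by decide
  constructor
  · intro hv
    have below : ∀ i, i < m → v i = 1 := fun i hi => by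
      rcases Int.units_eq_one_or (v i) with h | h
      · exact h
      · have := (hv i m hi).2.2 h (hlt _ _ (hv i m hi).1 h)
        exact absurd this (h1 (Set.mem_Iic.2 hi.le) (Set.mem_Iic.2 le_rfl) hi).asymm
    have above : ∀ i, m < i → v i = -1 := fun i hi => by
      rcases Int.units_eq_one_or (v i) with h | h
      · have := (hv m i hi).2.1 (hlt' _ _ (hv m i hi).1 h) h
        exact absurd this (h2 (Set.mem_Ici.2 le_rfl) (Set.mem_Ici.2 hi.le) hi).asymm
      · exact h
    rcases Int.units_eq_one_or (v m) with h | h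
    · right
      ext1 i
      split_ifs with hi
      · rcases hi.eq_or_lt with rfl | hi
        exacts [h, below i hi]
      · exact above i (not_le.1 hi)
    · left
      ext1 i
      split_ifs with hi
      · exact below i hi
      · rcases (not_lt.1 hi).eq_or_lt with rfl | hi
        exacts [h, above i hi]
  · have aux : ∀ p : Fin n → Prop, ∀ [DecidablePred p], (∀ i, p i → i ≤ m) → (∀ i, ¬ p i → m ≤ i) →
        (∀ i j, i < j → p j → p i) → IsAdapted π (fun i => if p i then 1 else -1) := by
      intro p _ hp hp' hp'' a b hab
      have hne : (-1 : ℤˣ) ≠ 1 := by decide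
      have hle : (-1 : ℤˣ) ≤ 1 := by decide
      have := hp'' a b hab
      by_cases ha : p a <;> by_cases hb : p b <;> simp_all [hne.symm]
      · exact h1 (hp a ha) (hp b hb) hab
      · exact h2 (hp' a ha) (hp' b hb) hab
    rintro (rfl | rfl)
    · exact aux (· < m) (fun i h => h.le) (fun i h => not_lt.1 h) fun i j h h' => h.trans h'
    · exact aux (· ≤ m) (fun i h => h) (fun i h => (not_le.1 h).le) fun i j h h' => h.le.trans h'

theorem isUnimodalWord_of_isAdapted {n : ℕ} [NeZero n] {π : Equiv.Perm (Fin n)} {v : Fin n → ℤˣ}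
    (hv : IsAdapted π v) : IsUnimodalWord (fun i => π i) := by
  -- The peak is where `π` is largest; the sign there is unconstrained, while all other signs are
  -- forced.
  obtain ⟨m, -, hm⟩ := Finset.exists_max_image Finset.univ π ⟨0, Finset.mem_univ _⟩
  have hlt : ∀ x y : ℤˣ, y ≤ x → x = -1 → y = -1 := by decide
  have hlt' : ∀ x y : ℤˣ, y ≤ x → y = 1 → x = 1 := by decide
  have hmx : ∀ i, i ≠ m → π i < π m := fun i hi =>
    (hm i (Finset.mem_univ i)).lt_of_ne (π.injective.ne hi)
  have below : ∀ i, i < m → v i = 1 := fun i hi => by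
    rcases Int.units_eq_one_or (v i) with h | h
    · exact h
    · exact absurd ((hv i m hi).2.2 h (hlt _ _ (hv i m hi).1 h)) (hmx i hi.ne).asymm
  have above : ∀ i, m < i → v i = -1 := fun i hi => by
    rcases Int.units_eq_one_or (v i) with h | h
    · exact absurd ((hv m i hi).2.1 (hlt' _ _ (hv m i hi).1 h) h) (hmx i hi.ne').asymm
    · exact h
  refine ⟨m, fun a ha b hb hab => ?_, fun a ha b hb hab => ?_⟩
  · rcases (Set.mem_Iic.1 hb).eq_or_lt with rfl | hb
    · exact hmx a hab.ne
    · exact (hv a b hab).2.1 (below a (hab.trans hb)) (below b hb)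
  · rcases (Set.mem_Ici.1 ha).eq_or_lt with rfl | ha
    · exact hmx b hab.ne'
    · exact (hv a b hab).2.2 (above a ha) (above b (ha.trans hab))

theorem des_of_unimodal {n : ℕ} {π : Equiv.Perm (Fin n)} {m : Fin n}
    (h1 : StrictMonoOn π (Set.Iic m)) (h2 : StrictAntiOn π (Set.Ici m)) :
    des π = (Finset.Ioi m).card := by
  symm
  refine Finset.card_bij (fun j _ => ⟨(j : ℕ) - 1, by omega⟩) ?_ ?_ ?_
  · intro j hj
    have hj : (m : ℕ) < j := Fin.lt_def.1 (Finset.mem_Ioi.1 hj)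
    have hjn := j.2
    simp only [descentSet, Finset.mem_filter, Finset.mem_univ, true_and]
    exact ⟨by omega, h2 (Fin.le_def.2 (by simp; omega)) (Fin.le_def.2 (by simp; omega))
      (Fin.lt_def.2 (by simp))⟩
  · intro i hi j hj h
    have hi : (m : ℕ) < i := Fin.lt_def.1 (Finset.mem_Ioi.1 hi)
    have hj : (m : ℕ) < j := Fin.lt_def.1 (Finset.mem_Ioi.1 hj)
    have := Fin.ext_iff.1 h
    ext
    simp only at this
    omega
  · intro i hi
    obtain ⟨h, hi⟩ : ∃ h : (i : ℕ) + 1 < n, π ⟨(i : ℕ) + 1, h⟩ < π i := by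
      simpa [descentSet] using hi
    refine ⟨⟨(i : ℕ) + 1, h⟩, ?_, by simp⟩
    rw [Finset.mem_Ioi]
    by_contra hm
    have hm := not_lt.1 hm
    have hlt : i < ⟨(i : ℕ) + 1, h⟩ := Fin.lt_def.2 (Nat.lt_succ_self _)
    exact (h1 (Set.mem_Iic.2 (hlt.le.trans hm)) (Set.mem_Iic.2 hm) hlt).asymm hi

open Classical in
-- Without the marked -1 the two adapted words would cancel; with it, a word having k letters -1
-- counts k·(-1)^k.
theorem sum_isAdapted {n : ℕ} [NeZero n] (π : Equiv.Perm (Fin n)) :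
    ∑ v : Fin n → ℤˣ with IsAdapted π v, ∑ i, (if v i = -1 then ((∏ j, v j : ℤˣ) : ℤ) else 0) =
      if IsUnimodalWord (fun i => π i) then -(-1) ^ des π else 0 := by
  split_ifs with h
  · obtain ⟨m, h1, h2⟩ := h
    have hset : (Finset.univ.filter fun v : Fin n → ℤˣ => IsAdapted π v) =
        {(fun i => if i < m then 1 else -1), fun i => if i ≤ m then 1 else -1} := by
      ext v
      simp [isAdapted_iff_of_unimodal h1 h2]
    have hne : (-1 : ℤˣ) ≠ 1 := by decide
    have hval : ∀ p : Fin n → Prop, ∀ [DecidablePred p] (k : ℕ),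
        (Finset.univ.filter fun i => ¬ p i).card = k →
        ∑ i, (if (if p i then (1 : ℤˣ) else -1) = -1 then
          ((∏ j, (if p j then (1 : ℤˣ) else -1) : ℤˣ) : ℤ) else 0) = k * (-1) ^ k := by
      intro p _ k hk
      have hprod : (∏ j, (if p j then (1 : ℤˣ) else -1)) = (-1) ^ k := by
        rw [Finset.prod_ite]; simp [hk]
      have hiff : ∀ i, ((if p i then (1 : ℤˣ) else -1) = -1) ↔ ¬ p i := fun i => by
        by_cases hp : p i <;> simp [hp, hne.symm]
      simp only [hiff, hprod]
      rw [← Finset.sum_filter, Finset.sum_const, hk]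
      simp
    rw [hset, Finset.sum_pair, hval (· < m) (des π + 1), hval (· ≤ m) (des π)]
    · push_cast; ring
    · rw [des_of_unimodal h1 h2]; congr 1; ext; simp
    · rw [des_of_unimodal h1 h2]
      have : (Finset.univ.filter fun i => ¬ i < m) = Finset.Ici m := by ext; simp
      rw [this, Fin.card_Ici, Fin.card_Ioi]
      have := m.2
      omega
    · intro h
      have := congrFun h m
      simp at this
  · refine Finset.sum_eq_zero fun v hv => ?_
    exact absurd (isUnimodalWord_of_isAdapted (by simpa using hv)) h

/-! ### Block signs and periods of circular words -/

/-- The product of the `k` letters of the circular word `w` that start at position `a`. -/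
def blockSign {n : ℕ} (w : ZMod n → ℤˣ) (a : ZMod n) (k : ℕ) : ℤˣ :=
  ∏ i ∈ Finset.range k, w (a + i)

/-- `q` is a period of the circular word `w`. -/
def HasPeriod {n : ℕ} (w : ZMod n → ℤˣ) (q : ℕ) : Prop :=
  ∀ a, w (a + q) = w a

@[simp] theorem blockSign_zero {n : ℕ} (w : ZMod n → ℤˣ) (a : ZMod n) : blockSign w a 0 = 1 := rfl

theorem blockSign_succ {n : ℕ} (w : ZMod n → ℤˣ) (a : ZMod n) (k : ℕ) :
    blockSign w a (k + 1) = blockSign w a k * w (a + k) :=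
  Finset.prod_range_succ _ _

theorem blockSign_one {n : ℕ} (w : ZMod n → ℤˣ) (a : ZMod n) : blockSign w a 1 = w a := by
  simp [blockSign]

theorem blockSign_add {n : ℕ} (w : ZMod n → ℤˣ) (a : ZMod n) (k l : ℕ) :
    blockSign w a (k + l) = blockSign w a k * blockSign w (a + k) l := by
  simp [blockSign, Finset.prod_range_add, add_assoc]

theorem blockSign_succ' {n : ℕ} (w : ZMod n → ℤˣ) (a : ZMod n) (k : ℕ) :
    blockSign w a (k + 1) = w a * blockSign w (a + 1) k := by
  rw [add_comm, blockSign_add, blockSign_one, Nat.cast_one]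

theorem prod_eq_blockSign {n : ℕ} [NeZero n] (w : ZMod n → ℤˣ) : ∏ a, w a = blockSign w 0 n := by
  refine Finset.prod_nbij' (fun a => a.val) (fun i => (i : ZMod n)) ?_ ?_ ?_ ?_ ?_
  · exact fun a _ => Finset.mem_range.2 a.val_lt
  · simp
  · simp
  · exact fun i hi => ZMod.val_cast_of_lt (Finset.mem_range.1 hi)
  · simp

/-- Sliding the window by one drops `w a` and gains `w (a + q)`, which is the same letter. -/
theorem HasPeriod.blockSign_eq {n q : ℕ} [NeZero n] {w : ZMod n → ℤˣ} (h : HasPeriod w q)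
    (a : ZMod n) : blockSign w a q = blockSign w 0 q := by
  have key : ∀ k : ℕ, blockSign w (k : ZMod n) q = blockSign w 0 q := fun k => by
    induction k with
    | zero => simp
    | succ k ih =>
      rw [← ih]
      have := blockSign_succ w k q
      rw [blockSign_succ', h k, mul_comm] at this
      simpa using mul_right_cancel this
  simpa using key a.val

theorem HasPeriod.mul_left {n q : ℕ} {w : ZMod n → ℤˣ} (h : HasPeriod w q) (k : ℕ) :
    HasPeriod w (k * q) := by
  induction k with
  | zero => intro a; simp
  | succ k ih =>
    intro a
    rw [← ih a, ← h (a + (k * q : ℕ))]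
    congr 1
    push_cast
    ring

theorem HasPeriod.blockSign_mul {n q : ℕ} [NeZero n] {w : ZMod n → ℤˣ} (h : HasPeriod w q)
    (k : ℕ) : blockSign w 0 (k * q) = blockSign w 0 q ^ k := by
  induction k with
  | zero => simp
  | succ k ih => rw [Nat.succ_mul, blockSign_add, ih, h.blockSign_eq (0 + _), pow_succ]

theorem hasPeriod_self {n : ℕ} (w : ZMod n → ℤˣ) : HasPeriod w n := fun a => by simp

/-- The smallest positive period of a circular word. -/
noncomputable def minPeriod {n : ℕ} (w : ZMod n → ℤˣ) : ℕ :=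
  Function.minimalPeriod (fun (v : ZMod n → ℤˣ) a => v (a + 1)) w

theorem hasPeriod_iff {n : ℕ} {w : ZMod n → ℤˣ} {q : ℕ} : HasPeriod w q ↔ minPeriod w ∣ q := by
  rw [minPeriod, ← Function.isPeriodicPt_iff_minimalPeriod_dvd, Function.IsPeriodicPt,
    Function.IsFixedPt]
  have : ∀ q : ℕ, (fun (v : ZMod n → ℤˣ) a => v (a + 1))^[q] w = fun a => w (a + q) := fun q => by
    induction q with
    | zero => simp
    | succ q ih =>
      rw [Function.iterate_succ_apply', ih]
      funext a
      change w (a + 1 + q) = w (a + (q + 1 : ℕ))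
      congr 1
      push_cast
      ring
  rw [this]
  exact funext_iff.symm

/-! ### Compatible labellings and the signed lexicographic order -/

/-- The labelling `σ` of the positions of the circular word `w` makes `w` adapted to the
permutation that the rotation induces on the labels. -/
def IsCompatible {n : ℕ} (w : ZMod n → ℤˣ) (σ : ZMod n ≃ Fin n) : Prop :=
  IsAdapted (transportRotation σ) (w ∘ σ.symm)

theorem isCompatible_iff {n : ℕ} {w : ZMod n → ℤˣ} {σ : ZMod n ≃ Fin n} :
    IsCompatible w σ ↔ ∀ a b, σ a < σ b → w b ≤ w a ∧ (w a = 1 → w b = 1 → σ (a + 1) < σ (b + 1)) ∧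
      (w a = -1 → w b = -1 → σ (b + 1) < σ (a + 1)) := by
  constructor
  · intro h a b hab
    simpa [transportRotation_apply] using h (σ a) (σ b) hab
  · intro h x y hxy
    obtain ⟨a, rfl⟩ := σ.surjective x
    obtain ⟨b, rfl⟩ := σ.surjective y
    simpa [transportRotation_apply] using h a b hxy

/-- Each common letter 1 preserves the order of the two labels and each -1 reverses it, so the block
sign records the net effect. -/
theorem IsCompatible.shift {n : ℕ} {w : ZMod n → ℤˣ} {σ : ZMod n ≃ Fin n} (h : IsCompatible w σ)
    {a b : ZMod n} (hab : σ a < σ b) (j : ℕ) (hw : ∀ i < j, w (a + i) = w (b + i)) :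
    (blockSign w a j = 1 → σ (a + j) < σ (b + j)) ∧
      (blockSign w a j = -1 → σ (b + j) < σ (a + j)) := by
  rw [isCompatible_iff] at h
  have hne : (1 : ℤˣ) ≠ -1 := by decide
  induction j with
  | zero => simpa [hne] using hab
  | succ j ih =>
    have ih := ih fun i hi => hw i (hi.trans (Nat.lt_succ_self j))
    have hj := hw j (Nat.lt_succ_self j)
    rw [blockSign_succ]
    have e : ∀ x : ZMod n, x + ((j + 1 : ℕ) : ZMod n) = x + j + 1 := fun x => by push_cast; ring
    rw [e, e]
    rcases Int.units_eq_one_or (blockSign w a j) with h1 | h1 <;>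
      rcases Int.units_eq_one_or (w (a + j)) with h2 | h2 <;> rw [h1, h2] <;>
      simp only [mul_one, mul_neg, neg_neg, hne, hne.symm, false_imp_iff,
        true_imp_iff, and_true, true_and]
    · exact (h _ _ (ih.1 h1)).2.1 h2 (hj ▸ h2)
    · exact (h _ _ (ih.1 h1)).2.2 h2 (hj ▸ h2)
    · exact (h _ _ (ih.2 h1)).2.1 (hj ▸ h2) h2
    · exact (h _ _ (ih.2 h1)).2.2 (hj ▸ h2) h2

/-- Shifting by `q` preserves the order of labels of tied positions. If `q` were nonzero mod `n`,
the labels of 0, q, 2q, … would be strictly monotone, yet they return to the start after `n` steps.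
-/
theorem IsCompatible.dvd_of_blockSign_eq_one {n q : ℕ} [NeZero n] {w : ZMod n → ℤˣ}
    {σ : ZMod n ≃ Fin n} (h : IsCompatible w σ) (hq : HasPeriod w q) (h1 : blockSign w 0 q = 1) :
    n ∣ q := by
  rw [← ZMod.natCast_eq_zero_iff]
  have key : ∀ {a b : ZMod n}, σ a < σ b → (∀ j : ℕ, w (a + j) = w (b + j)) →
      σ (a + q) < σ (b + q) := fun hab hw =>
    (h.shift hab q fun j _ => hw j).1 ((hq.blockSign_eq _).trans h1)
  have tie : ∀ k j : ℕ, w (((k * q : ℕ) : ZMod n) + j) = w (j : ZMod n) := fun k j => by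
    rw [add_comm]; exact hq.mul_left k _
  have hs : ∀ k : ℕ, (((k + 1) * q : ℕ) : ZMod n) = ((k * q : ℕ) : ZMod n) + q := fun k => by
    push_cast; ring
  have hn : σ ((n * q : ℕ) : ZMod n) = σ ((0 * q : ℕ) : ZMod n) := by simp
  by_contra hne
  rcases (σ.injective.ne (Ne.symm hne)).lt_or_gt with hlt | hlt
  · have mono : StrictMono fun k : ℕ => σ ((k * q : ℕ) : ZMod n) := by
      refine strictMono_nat_of_lt_succ fun k => ?_
      induction k with
      | zero => simpa using hlt
      | succ k ih =>
        rw [hs (k + 1)]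
        conv_lhs => rw [hs k]
        exact key ih fun j => (tie _ _).trans (tie _ _).symm
    exact (mono (NeZero.pos n)).ne hn.symm
  · have anti : StrictAnti fun k : ℕ => σ ((k * q : ℕ) : ZMod n) := by
      refine strictAnti_nat_of_succ_lt fun k => ?_
      induction k with
      | zero => simpa using hlt
      | succ k ih =>
        rw [hs (k + 1)]
        conv_rhs => rw [hs k]
        exact key ih fun j => (tie _ _).trans (tie _ _).symm
    exact (anti (NeZero.pos n)).ne hn

/-- The key of a position, by which compatible labellings order the positions. -/
def orderKey {n : ℕ} (w : ZMod n → ℤˣ) (a : ZMod n) : Lex (ℕ → ℤˣ) :=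
  toLex fun j => -blockSign w a (j + 1)

theorem orderKey_eq_iff {n : ℕ} {w : ZMod n → ℤˣ} {a b : ZMod n} :
    orderKey w a = orderKey w b ↔ ∀ j : ℕ, w (a + j) = w (b + j) := by
  constructor
  · intro h j
    have h' : ∀ j, blockSign w a j = blockSign w b j := fun j => by
      cases j with
      | zero => simp
      | succ j => exact neg_injective (congrFun (congrArg ofLex h) j)
    have := h' (j + 1)
    rw [blockSign_succ, blockSign_succ, h'] at this
    exact mul_left_cancel this
  · intro h
    refine congrArg toLex (funext fun j => congrArg _ (Finset.prod_congr rfl fun i _ => h i))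

theorem orderKey_lt_iff {n : ℕ} {w : ZMod n → ℤˣ} {a b : ZMod n} :
    orderKey w a < orderKey w b ↔ ∃ j, (∀ i < j, blockSign w a (i + 1) = blockSign w b (i + 1)) ∧
      -blockSign w a (j + 1) < -blockSign w b (j + 1) := by
  refine exists_congr fun j => and_congr (forall₂_congr fun i _ => ?_) Iff.rfl
  exact neg_inj

/-- At the first disagreement the sign of the common prefix tells whether the order has been
reversed, and letters 1 must precede letters -1. The minus sign in `orderKey` puts 1 first. -/
theorem IsCompatible.orderKey_le {n : ℕ} {w : ZMod n → ℤˣ} {σ : ZMod n ≃ Fin n}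
    (h : IsCompatible w σ) {a b : ZMod n} (hab : σ a < σ b) : orderKey w a ≤ orderKey w b := by
  by_cases htie : ∀ j : ℕ, w (a + j) = w (b + j)
  · exact (orderKey_eq_iff.2 htie).le
  · refine le_of_lt (orderKey_lt_iff.2 ?_)
    push Not at htie
    classical
    obtain ⟨j, hj, hmin⟩ : ∃ j : ℕ, w (a + j) ≠ w (b + j) ∧ ∀ i < j, w (a + i) = w (b + i) :=
      ⟨Nat.find htie, Nat.find_spec htie, fun i hi => not_not.1 (Nat.find_min htie hi)⟩
    have hbs : ∀ i ≤ j, blockSign w a i = blockSign w b i := fun i hi =>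
      Finset.prod_congr rfl fun k hk => hmin k ((Finset.mem_range.1 hk).trans_le hi)
    refine ⟨j, fun i hi => hbs _ hi, ?_⟩
    have hs := h.shift hab j hmin
    rw [isCompatible_iff] at h
    rw [blockSign_succ, blockSign_succ, ← hbs j le_rfl]
    have d1 : ∀ x y : ℤˣ, x ≠ y → y ≤ x → -(1 * x) < -(1 * y) := by decide
    have d2 : ∀ x y : ℤˣ, x ≠ y → x ≤ y → -(-1 * x) < -(-1 * y) := by decide
    rcases Int.units_eq_one_or (blockSign w a j) with h1 | h1 <;> rw [h1]
    · exact d1 _ _ hj (h _ _ (hs.1 h1)).1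
    · exact d2 _ _ hj (h _ _ (hs.2 h1)).1

theorem Equiv.eq_of_lt_imp_lt {α : Type*} {n : ℕ} {σ τ : α ≃ Fin n}
    (h : ∀ a b, σ a < σ b → τ a < τ b) : σ = τ := by
  have hm : StrictMono (σ.symm.trans τ) := fun x y hxy => h _ _ (by simpa using hxy)
  have : (hm.orderIsoOfSurjective _ (σ.symm.trans τ).surjective) = OrderIso.refl (Fin n) :=
    Subsingleton.elim _ _
  ext1 a
  have := DFunLike.congr_fun this (σ a)
  simpa using this.symm

theorem IsCompatible.eq {n : ℕ} {w : ZMod n → ℤˣ} {σ τ : ZMod n ≃ Fin n}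
    (hσ : IsCompatible w σ) (hτ : IsCompatible w τ)
    (h : ∀ a b, orderKey w a = orderKey w b → σ a < σ b → τ a < τ b) : σ = τ := by
  refine Equiv.eq_of_lt_imp_lt fun a b hab => ?_
  rcases (hσ.orderKey_le hab).eq_or_lt with he | hlt
  · exact h a b he hab
  · rcases lt_trichotomy (τ a) (τ b) with h' | h' | h'
    · exact h'
    · exact absurd (congrArg σ (τ.injective h')) hab.ne
    · exact absurd (hτ.orderKey_le h') hlt.not_ge

/-- Positions are sorted by key, with ties broken by `ε`. The rule for `ε (a + 1)` makes the
tie-break itself preserved by a letter 1 and reversed by -1. -/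
theorem exists_isCompatible {n : ℕ} [NeZero n] (w ε : ZMod n → ℤˣ)
    (hε : ∀ a b, a ≠ b → orderKey w a = orderKey w b → ε (a + 1) = w a * ε a ∧ ε a ≠ ε b) :
    ∃ σ : ZMod n ≃ Fin n, IsCompatible w σ ∧
      ∀ a b, orderKey w a = orderKey w b → ε a < ε b → σ a < σ b := by
  let key : ZMod n → Lex (ℕ → ℤˣ) ×ₗ ℤˣ := fun a => toLex (orderKey w a, ε a)
  have hkey : Function.Injective key := fun a b hab => by
    by_contra hne
    have := Prod.ext_iff.1 (toLex.injective hab)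
    exact (hε a b hne this.1).2 this.2
  have hlt : ∀ a b, key a < key b ↔ orderKey w a < orderKey w b ∨
      orderKey w a = orderKey w b ∧ ε a < ε b := fun a b => Prod.Lex.toLex_lt_toLex
  let _ : LinearOrder (ZMod n) := LinearOrder.lift' key hkey
  let σ : ZMod n ≃ Fin n := (Fintype.orderIsoFinOfCardEq (ZMod n) (ZMod.card n)).symm.toEquiv
  have hσ : ∀ a b, σ a < σ b ↔ key a < key b := fun a b => by
    rw [show σ a < σ b ↔ a < b from
      (Fintype.orderIsoFinOfCardEq (ZMod n) (ZMod.card n)).symm.lt_iff_lt]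
    exact Iff.rfl
  refine ⟨σ, isCompatible_iff.2 fun a b hab => ?_, fun a b h1 h2 => (hσ a b).2 ((hlt a b).2 (.inr ⟨h1, h2⟩))⟩
  have hab := (hlt a b).1 ((hσ a b).1 hab)
  have tie : orderKey w a = orderKey w b → w a = w b ∧ orderKey w (a + 1) = orderKey w (b + 1) := by
    simp only [orderKey_eq_iff]
    intro h
    refine ⟨by simpa using h 0, fun j => ?_⟩
    have := h (j + 1)
    push_cast at this
    rw [add_comm (j : ZMod n), ← add_assoc, ← add_assoc] at this
    exact this
  have ties : orderKey w a = orderKey w b → ε a < ε b → ε (a + 1) = w a * ε a ∧ ε (b + 1) = w b * ε b :=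
    fun h h' => by
      have hne : a ≠ b := fun h => h'.ne (congrArg ε h)
      exact ⟨(hε a b hne h).1, (hε b a hne.symm h.symm).1⟩
  have nt : w a = w b → orderKey w a < orderKey w b →
      (w a = 1 → orderKey w (a + 1) < orderKey w (b + 1)) ∧
      (w a = -1 → orderKey w (b + 1) < orderKey w (a + 1)) := by
    intro hw h
    obtain ⟨j, h1, h2⟩ := orderKey_lt_iff.1 h
    cases j with
    | zero => simp [blockSign_one, hw] at h2
    | succ j =>
      have h3 : ∀ i < j, blockSign w (a + 1) (i + 1) = blockSign w (b + 1) (i + 1) := fun i hi => by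
        have := h1 (i + 1) (by omega)
        rw [blockSign_succ', blockSign_succ' w b, hw] at this
        exact mul_left_cancel this
      rw [blockSign_succ', blockSign_succ' w b, ← hw] at h2
      have d : ∀ x y : ℤˣ, -(-1 * x) < -(-1 * y) → -y < -x := by decide
      refine ⟨fun h => ?_, fun h => ?_⟩
      · rw [h, one_mul, one_mul] at h2
        exact orderKey_lt_iff.2 ⟨j, h3, h2⟩
      · rw [h] at h2
        exact orderKey_lt_iff.2 ⟨j, fun i hi => (h3 i hi).symm, d _ _ h2⟩
  simp only [hσ, hlt]
  refine ⟨?_, fun ha hb => ?_, fun ha hb => ?_⟩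
  · rcases hab with h | ⟨h, -⟩
    · obtain ⟨j, h1, h2⟩ := orderKey_lt_iff.1 h
      have d : ∀ x y : ℤˣ, -x < -y → y ≤ x := by decide
      cases j with
      | zero => rw [blockSign_one, blockSign_one] at h2; exact d _ _ h2
      | succ j =>
        have := h1 0 (Nat.succ_pos j)
        rw [blockSign_one, blockSign_one] at this
        exact this.ge
    · exact (tie h).1.ge
  · rcases hab with h | ⟨h, h'⟩
    · exact .inl ((nt (ha.trans hb.symm) h).1 ha)
    · refine .inr ⟨(tie h).2, ?_⟩
      rw [(ties h h').1, (ties h h').2, ha, hb, one_mul, one_mul]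
      exact h'
  · rcases hab with h | ⟨h, h'⟩
    · exact .inl ((nt (ha.trans hb.symm) h).2 ha)
    · refine .inr ⟨(tie h).2.symm, ?_⟩
      have d : ∀ x y : ℤˣ, x < y → -1 * y < -1 * x := by decide
      rw [(ties h h').1, (ties h h').2, ha, hb]
      exact d _ _ h'

/-! ### Counting compatible labellings -/

theorem minPeriod_dvd {n : ℕ} (w : ZMod n → ℤˣ) : minPeriod w ∣ n :=
  hasPeriod_iff.1 (hasPeriod_self w)

theorem hasPeriod_minPeriod {n : ℕ} (w : ZMod n → ℤˣ) : HasPeriod w (minPeriod w) :=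
  hasPeriod_iff.2 dvd_rfl

theorem orderKey_eq_iff_dvd {n : ℕ} [NeZero n] {w : ZMod n → ℤˣ} {a b : ZMod n} :
    orderKey w a = orderKey w b ↔ minPeriod w ∣ (b - a).val := by
  rw [orderKey_eq_iff, ← hasPeriod_iff]
  constructor
  · intro h c
    have := h (c - a).val
    simp only [ZMod.natCast_val, ZMod.cast_id', id_eq, add_sub_cancel] at this
    rw [this]
    congr 1
    simp only [ZMod.natCast_val, ZMod.cast_id', id_eq]
    ring
  · intro h j
    rw [← h (a + j)]
    congr 1
    simp only [ZMod.natCast_val, ZMod.cast_id', id_eq]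
    ring

open Classical in
/-- The number of compatible labellings of a circular word. -/
noncomputable def compatibleCount {n : ℕ} [NeZero n] (w : ZMod n → ℤˣ) : ℕ :=
  (Finset.univ.filter fun σ : ZMod n ≃ Fin n => IsCompatible w σ).card

theorem compatibleCount_eq_zero {n : ℕ} [NeZero n] {w : ZMod n → ℤˣ} {e : ℕ}
    (he : n = e * minPeriod w) (h : ¬ e ∣ 2 ∨ blockSign w 0 (minPeriod w) = 1 ∧ e ≠ 1) :
    compatibleCount w = 0 := by
  classical
  rw [compatibleCount, Finset.card_eq_zero, Finset.filter_eq_empty_iff]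
  intro σ _ hσ
  have hp := hasPeriod_minPeriod w
  have hpos : 0 < minPeriod w := Nat.pos_of_ne_zero fun h0 => NeZero.ne n (by rw [he, h0, mul_zero])
  rcases h with h | ⟨h, h'⟩
  -- Two minimal periods always have sign 1, being a square.
  · have := hσ.dvd_of_blockSign_eq_one (hp.mul_left 2) (by rw [hp.blockSign_mul, Int.units_sq])
    exact h (Nat.dvd_of_mul_dvd_mul_right hpos (he.symm.dvd.trans this))
  · have := hσ.dvd_of_blockSign_eq_one hp h
    exact h' (Nat.dvd_one.1 (Nat.dvd_of_mul_dvd_mul_right hpos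
      (he.symm.dvd.trans (this.trans (one_mul _).symm.dvd))))

theorem compatibleCount_eq_one {n : ℕ} [NeZero n] {w : ZMod n → ℤˣ} (h : n = minPeriod w) :
    compatibleCount w = 1 := by
  have tie : ∀ a b, orderKey w a = orderKey w b → a = b := fun a b hab => by
    rw [orderKey_eq_iff_dvd, ← h] at hab
    have := Nat.eq_zero_of_dvd_of_lt hab (ZMod.val_lt _)
    rw [ZMod.val_eq_zero, sub_eq_zero] at this
    exact this.symm
  obtain ⟨σ, hσ, -⟩ := exists_isCompatible w 1 fun a b hab h => absurd (tie a b h) hab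
  rw [compatibleCount, Finset.card_eq_one]
  refine ⟨σ, Finset.eq_singleton_iff_unique_mem.2 ⟨by simpa using hσ, fun τ hτ => ?_⟩⟩
  refine IsCompatible.eq (by simpa using hτ) hσ fun a b hab hlt => ?_
  rw [tie a b hab] at hlt
  exact absurd hlt (lt_irrefl _)

/-- Ties are exactly the pairs `a`, `a + p`. The order of 0 and `p` propagates to all of them, and
both choices occur. -/
theorem compatibleCount_eq_two {n : ℕ} [NeZero n] {w : ZMod n → ℤˣ} (h : n = 2 * minPeriod w)
    (hs : blockSign w 0 (minPeriod w) = -1) : compatibleCount w = 2 := by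
  have hp := hasPeriod_minPeriod w
  set p := minPeriod w with hpdef
  have hpos : 0 < p := Nat.pos_of_ne_zero fun h0 => NeZero.ne n (by rw [h, h0, mul_zero])
  have hne : (-1 : ℤˣ) ≠ 1 := by decide
  have hpp : (p : ZMod n) + p = 0 := by
    rw [← two_mul]
    have := ZMod.natCast_self n
    rw [h] at this ⊢
    push_cast at this
    exact this
  have hp0 : (0 : ZMod n) ≠ p := fun h0 => by
    have := Nat.le_of_dvd hpos ((ZMod.natCast_eq_zero_iff _ _).1 h0.symm)
    omega
  have tie : ∀ a b, orderKey w a = orderKey w b → a ≠ b → b = a + p := fun a b hab hne => by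
    rw [orderKey_eq_iff_dvd, ← hpdef] at hab
    obtain ⟨k, hk⟩ := hab
    have hlt := ZMod.val_lt (b - a)
    rw [hk] at hlt
    have hk2 : k < 2 := by
      have : p * k < p * 2 := by omega
      exact Nat.lt_of_mul_lt_mul_left this
    have hk0 : k ≠ 0 := fun h0 => by
      rw [h0, mul_zero, ZMod.val_eq_zero, sub_eq_zero] at hk
      exact hne hk.symm
    have : k = 1 := by omega
    rw [this, mul_one] at hk
    have := ZMod.natCast_zmod_val (b - a)
    rw [hk] at this
    rw [this]
    ring
  have key : ∀ a, orderKey w a = orderKey w (a + p) := fun a => by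
    rw [orderKey_eq_iff]
    intro j
    rw [← hp (a + j)]
    congr 1
    ring
  -- The accumulated sign from 0. It is consistent around the circle because a full turn has sign
  -- (-1)^2 = 1, and it changes sign under a shift by `p`, so `E` and `-E` both serve as
  -- tie-breakers.
  let E : ZMod n → ℤˣ := fun a => blockSign w 0 a.val
  have hE : ∀ k : ℕ, E k = blockSign w 0 k := fun k => by
    have hn : blockSign w 0 n = 1 := by
      have := hp.blockSign_mul 2
      rwa [← h, Int.units_sq] at this
    change blockSign w 0 (k : ZMod n).val = _
    conv_rhs => rw [← Nat.div_add_mod' k n]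
    rw [blockSign_add, (hasPeriod_self w).blockSign_mul, hn, ZMod.val_natCast]
    simp
  have hE1 : ∀ a, E (a + 1) = w a * E a := fun a => by
    have := hE (a.val + 1)
    rw [blockSign_succ, ← hE] at this
    push_cast at this
    simpa [mul_comm] using this
  have hEp : ∀ a, E (a + p) = -E a := fun a => by
    have := hE (a.val + p)
    rw [blockSign_add, hp.blockSign_eq, ← hE, hs] at this
    push_cast at this
    simpa using this
  have hE0 : E 0 = 1 := by simp [E]
  have hx : ∀ δ : ℤˣ, ∃ σ : ZMod n ≃ Fin n, IsCompatible w σ ∧ (σ 0 < σ p ↔ δ = -1) := fun δ => by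
    obtain ⟨σ, hσ, hσ'⟩ := exists_isCompatible w (fun a => δ * E a) fun a b hab ht => by
      rw [hE1, tie a b ht hab, hEp]
      refine ⟨by rw [mul_left_comm], ?_⟩
      rcases Int.units_eq_one_or δ with rfl | rfl <;>
        rcases Int.units_eq_one_or (E a) with h | h <;> rw [h] <;> decide
    refine ⟨σ, hσ, ?_⟩
    have hEpp : E p = -1 := by have := hEp 0; rwa [zero_add, hE0] at this
    have k0 := key 0
    rw [zero_add] at k0
    rcases Int.units_eq_one_or δ with rfl | rfl
    · have := hσ' p 0 k0.symm (by rw [hEpp, hE0]; decide)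
      simp [this.not_gt, hne.symm]
    · have := hσ' 0 p k0 (by rw [hEpp, hE0]; decide)
      simp [this]
  have hu : ∀ σ : ZMod n ≃ Fin n, IsCompatible w σ → ∀ a,
      (E a = 1 → (σ a < σ (a + p) ↔ σ 0 < σ p)) ∧ (E a = -1 → (σ a < σ (a + p) ↔ σ p < σ 0)) := by
    intro σ hσ a
    have ht : ∀ j : ℕ, w (0 + j) = w (p + j) := by
      have := key 0
      rw [zero_add] at this
      exact orderKey_eq_iff.1 this
    have ht' : ∀ j : ℕ, w (p + j) = w (0 + j) := fun j => (ht j).symm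
    have hval : (p : ZMod n) + (a.val : ZMod n) = a + p := by simp [add_comm]
    have hval' : (0 : ZMod n) + (a.val : ZMod n) = a := by simp
    have hb : blockSign w p a.val = E a := Finset.prod_congr rfl fun i _ => ht' i
    rcases (σ.injective.ne hp0).lt_or_gt with hlt | hlt
    · have := hσ.shift hlt a.val fun j _ => ht j
      rw [hval, hval'] at this
      exact ⟨fun h => iff_of_true (this.1 h) hlt, fun h => iff_of_false (this.2 h).asymm hlt.asymm⟩
    · have := hσ.shift hlt a.val fun j _ => ht' j
      rw [hval, hval', hb] at this
      exact ⟨fun h => iff_of_false (this.1 h).asymm hlt.asymm, fun h => iff_of_true (this.2 h) hlt⟩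
  have huniq : ∀ σ τ : ZMod n ≃ Fin n, IsCompatible w σ → IsCompatible w τ →
      (σ 0 < σ p ↔ τ 0 < τ p) → σ = τ := by
    intro σ τ hσ hτ hst
    refine hσ.eq hτ fun a b hab hlt => ?_
    have hst' : σ p < σ 0 ↔ τ p < τ 0 := by
      rw [← not_le, ← not_le, le_iff_lt_or_eq, le_iff_lt_or_eq, hst, σ.injective.eq_iff,
        τ.injective.eq_iff]
    obtain rfl := tie a b hab fun h => hlt.ne (congrArg σ h)
    rcases Int.units_eq_one_or (E a) with h | h
    · exact ((hu τ hτ a).1 h).2 (hst.1 (((hu σ hσ a).1 h).1 hlt))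
    · exact ((hu τ hτ a).2 h).2 (hst'.1 (((hu σ hσ a).2 h).1 hlt))
  obtain ⟨σ, hσ, hσ'⟩ := hx 1
  obtain ⟨τ, hτ, hτ'⟩ := hx (-1)
  rw [compatibleCount, Finset.card_eq_two]
  refine ⟨σ, τ, ?_, ?_⟩
  · rintro rfl
    exact hne.symm (hσ'.1 (hτ'.2 rfl))
  · ext ρ
    simp only [Finset.mem_filter, Finset.mem_univ, true_and, Finset.mem_insert,
      Finset.mem_singleton]
    constructor
    · intro hρ
      by_cases hl : ρ 0 < ρ p
      · exact .inr (huniq ρ τ hρ hτ (by simp [hl, hτ']))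
      · exact .inl (huniq ρ σ hρ hσ (by simp [hl, hσ', hne.symm]))
    · rintro (rfl | rfl) <;> assumption

/-! ### Möbius inversion -/

open ArithmeticFunction in
theorem sum_divisors_moebius {e : ℕ} :
    ∑ d ∈ e.divisors, moebius d = if e = 1 then 1 else 0 := by
  rw [← coe_mul_zeta_apply, moebius_mul_coe_zeta, one_apply]

open ArithmeticFunction in
-- Write (-1)^k as -1 plus 2 when k is even; the d with e/d even are the divisors of e/2.
theorem sum_divisors_moebius_mul_neg_one_pow {e : ℕ} (he : e ≠ 0) :
    ∑ d ∈ e.divisors, moebius d * (-1) ^ (e / d) =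
      -(if e = 1 then 1 else 0) + 2 * if e = 2 then 1 else 0 := by
  have h1 : ∀ d ∈ e.divisors, moebius d * (-1) ^ (e / d) =
      -moebius d + 2 * if Even (e / d) then moebius d else 0 := fun d _ => by
    split_ifs with h
    · rw [h.neg_one_pow]; ring
    · rw [(Nat.not_even_iff_odd.1 h).neg_one_pow]; ring
  rw [Finset.sum_congr rfl h1, Finset.sum_add_distrib, Finset.sum_neg_distrib,
    sum_divisors_moebius, ← Finset.mul_sum, ← Finset.sum_filter]
  congr 2
  by_cases h2 : 2 ∣ e
  · obtain ⟨f, rfl⟩ := h2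
    have : (2 * f).divisors.filter (fun d => Even (2 * f / d)) = f.divisors := by
      ext d
      simp only [Finset.mem_filter, Nat.mem_divisors]
      constructor
      · rintro ⟨⟨⟨k, hk⟩, h0⟩, hev⟩
        have hd : 0 < d := Nat.pos_of_ne_zero fun h => he (by rw [hk, h, zero_mul])
        rw [hk, Nat.mul_div_cancel_left _ hd] at hev
        obtain ⟨l, rfl⟩ := hev
        exact ⟨⟨l, by linarith⟩, by omega⟩
      · rintro ⟨⟨k, rfl⟩, h0⟩
        have hd : 0 < d := Nat.pos_of_ne_zero fun h => h0 (by rw [h, zero_mul])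
        refine ⟨⟨⟨2 * k, by ring⟩, he⟩, ?_⟩
        rw [show 2 * (d * k) = d * (2 * k) by ring, Nat.mul_div_cancel_left _ hd]
        exact even_two_mul k
    rw [this, sum_divisors_moebius]
    congr 1
    simp
  · rw [if_neg (by rintro rfl; exact h2 dvd_rfl), Finset.filter_false_of_mem, Finset.sum_empty]
    intro d hd hev
    exact h2 (hev.two_dvd.trans (Nat.div_dvd_of_dvd (Nat.dvd_of_mem_divisors hd)))

open Classical ArithmeticFunction in
-- With n = e·p and s the sign of the minimal period, n/d is a period exactly when d divides e. Both
-- sides then depend only on e and s: s^e times the count against the sum of μ(d)·s^(e/d).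
theorem prod_mul_compatibleCount {n : ℕ} [NeZero n] (w : ZMod n → ℤˣ) :
    ((∏ a, w a : ℤˣ) : ℤ) * compatibleCount w =
      ∑ d ∈ n.divisors, if HasPeriod w (n / d) then moebius d * (blockSign w 0 (n / d) : ℤ) else 0 := by
  have hp := hasPeriod_minPeriod w
  obtain ⟨e, he⟩ := minPeriod_dvd w
  rw [mul_comm] at he
  set p := minPeriod w with hpdef
  have hp0 : 0 < p := Nat.pos_of_ne_zero fun h0 => NeZero.ne n (by rw [he, h0, mul_zero])
  have he0 : e ≠ 0 := fun h0 => NeZero.ne n (by rw [he, h0, zero_mul])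
  have hset : n.divisors.filter (fun d => HasPeriod w (n / d)) = e.divisors := by
    ext d
    simp only [Finset.mem_filter, Nat.mem_divisors, hasPeriod_iff, ← hpdef]
    constructor
    · rintro ⟨⟨hd, -⟩, hdp⟩
      refine ⟨Nat.dvd_of_mul_dvd_mul_right hp0 ?_, he0⟩
      rw [← he]
      exact (mul_dvd_mul_left d hdp).trans (Nat.mul_div_cancel' hd).dvd
    · rintro ⟨⟨k, rfl⟩, -⟩
      have hd : 0 < d := Nat.pos_of_ne_zero fun h => he0 (by rw [h, zero_mul])
      have hn : n / d = k * p := by rw [he, mul_assoc, Nat.mul_div_cancel_left _ hd]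
      rw [hn]
      exact ⟨⟨⟨k * p, by rw [he, mul_assoc]⟩, NeZero.ne n⟩, dvd_mul_left _ _⟩
  have hval : ∀ d ∈ e.divisors, moebius d * (blockSign w 0 (n / d) : ℤ) =
      moebius d * ((blockSign w 0 p ^ (e / d) : ℤˣ) : ℤ) := fun d hd => by
    have : n / d = e / d * p := by rw [he, Nat.mul_div_right_comm (Nat.dvd_of_mem_divisors hd)]
    rw [← hp.blockSign_mul, this]
  have hprod : ∏ a, w a = blockSign w 0 p ^ e := by
    rw [prod_eq_blockSign, ← hp.blockSign_mul]
    exact congrArg _ he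
  rw [← Finset.sum_filter, hset, Finset.sum_congr rfl hval, hprod]
  rcases Int.units_eq_one_or (blockSign w 0 p) with hs | hs <;> rw [hs]
  · simp only [one_pow, Units.val_one, one_mul, mul_one]
    rw [sum_divisors_moebius]
    split_ifs with h1
    · rw [compatibleCount_eq_one (by rw [← hpdef, he, h1, one_mul])]; rfl
    · rw [compatibleCount_eq_zero he (.inr ⟨hs, h1⟩)]; rfl
  · simp only [Units.val_pow_eq_pow_val, Units.val_neg, Units.val_one]
    rw [sum_divisors_moebius_mul_neg_one_pow he0]
    by_cases h1 : e = 1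
    · rw [compatibleCount_eq_one (by rw [← hpdef, he, h1, one_mul]), h1]; rfl
    by_cases h2 : e = 2
    · rw [compatibleCount_eq_two (by rw [← hpdef, he, h2]) hs, h2]; rfl
    · rw [compatibleCount_eq_zero he (.inl fun h => ?_)]
      · simp [h1, h2]
      · rcases (Nat.dvd_prime Nat.prime_two).1 h with h | h
        exacts [h1 h, h2 h]

open Classical in
-- For `m > 1`, flipping the letters at positions congruent to 1 mod `m` negates the block sign, and
-- keeps both the period and `w 0`. For `m = 1` only the constant word -1 remains.
theorem sum_blockSign_of_hasPeriod {n m : ℕ} [NeZero n] (hm : m ∣ n) :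
    ∑ w : ZMod n → ℤˣ with w 0 = -1 ∧ HasPeriod w m, (blockSign w 0 m : ℤ) =
      if m = 1 then -1 else 0 := by
  have hm0 : 0 < m := Nat.pos_of_dvd_of_pos hm (NeZero.pos n)
  split_ifs with h1
  · subst h1
    have : (Finset.univ.filter fun w : ZMod n → ℤˣ => w 0 = -1 ∧ HasPeriod w 1) = {fun _ => -1} := by
      ext w
      simp only [Finset.mem_filter, Finset.mem_univ, true_and, Finset.mem_singleton]
      constructor
      · rintro ⟨h0, h⟩
        funext a
        have := h.mul_left a.val 0
        simpa [h0] using this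
      · rintro rfl
        exact ⟨rfl, fun a => rfl⟩
    rw [this, Finset.sum_singleton, blockSign_one]
    rfl
  · let f : ZMod n →+* ZMod m := ZMod.castHom hm (ZMod m)
    let g : ZMod n → ℤˣ := fun a => if f a = 1 then -1 else 1
    have hg : ∀ a, g (a + m) = g a := fun a => by simp [g]
    have hne : (-1 : ℤˣ) ≠ 1 := by decide
    have : Fact (1 < m) := ⟨by omega⟩
    have hg0 : g 0 = 1 := by simp [g]
    have hgb : blockSign g 0 m = -1 := by
      rw [blockSign, Finset.prod_eq_single 1]
      · simp [g]
      · intro i hi hi1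
        have hi := Finset.mem_range.1 hi
        have : (i : ZMod m) ≠ 1 := fun h => by
          rw [← Nat.cast_one, ZMod.natCast_eq_natCast_iff, Nat.ModEq, Nat.mod_eq_of_lt hi,
            Nat.mod_eq_of_lt (by omega)] at h
          exact hi1 h
        simp [g, this]
      · intro h
        exact absurd (Finset.mem_range.2 (by omega)) h
    have hmul : ∀ w, blockSign (w * g) 0 m = -blockSign w 0 m := fun w => by
      have : blockSign (w * g) 0 m = blockSign w 0 m * blockSign g 0 m :=
        Finset.prod_mul_distrib
      rw [this, hgb, mul_neg, mul_one]
    refine Finset.sum_involution (fun w _ => w * g) ?_ ?_ ?_ ?_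
    · intro w _
      rw [hmul]
      simp
    · intro w _ _ h
      have := hmul w
      rw [h] at this
      rcases Int.units_eq_one_or (blockSign w 0 m) with h | h <;> rw [h] at this <;>
        exact absurd this (by decide)
    · intro w hw
      simp only [Finset.mem_filter, Finset.mem_univ, true_and, Pi.mul_apply, hg0, mul_one] at hw ⊢
      exact ⟨hw.1, fun a => by rw [Pi.mul_apply, Pi.mul_apply, hw.2 a, hg]⟩
    · intro w _
      funext a
      simp [mul_assoc]

/-! ### Exchanging the summations -/

open Classical in
theorem sum_prod_mul_compatibleCount {n : ℕ} [NeZero n] :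
    ∑ w : ZMod n → ℤˣ with w 0 = -1, ((∏ a, w a : ℤˣ) : ℤ) * compatibleCount w =
      -ArithmeticFunction.moebius n := by
  simp only [prod_mul_compatibleCount]
  rw [Finset.sum_comm]
  have : ∀ d ∈ n.divisors, (∑ w : ZMod n → ℤˣ with w 0 = -1, if HasPeriod w (n / d) then
      ArithmeticFunction.moebius d * (blockSign w 0 (n / d) : ℤ) else 0) =
      if d = n then -ArithmeticFunction.moebius n else 0 := fun d hd => by
    have hd := Nat.dvd_of_mem_divisors hd
    rw [← Finset.sum_filter, Finset.filter_filter, ← Finset.mul_sum,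
      sum_blockSign_of_hasPeriod (Nat.div_dvd_of_dvd hd)]
    have : n / d = 1 ↔ d = n := by
      constructor
      · exact fun h => by rw [← Nat.div_mul_cancel hd, h, one_mul]
      · rintro rfl; exact Nat.div_self (NeZero.pos d)
    by_cases h : d = n
    · rw [if_pos (this.2 h), if_pos h, h, mul_neg, mul_one]
    · rw [if_neg (mt this.1 h), if_neg h, mul_zero]
  rw [Finset.sum_congr rfl this, Finset.sum_ite_eq' , if_pos (Nat.mem_divisors_self n (NeZero.ne n))]

open Classical in
-- Pulling `v` back along `σ` turns the marked letter -1 into the condition `w 0 = -1`, which no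
-- longer mentions `σ`; this is what allows summing over `σ` first.
theorem sum_isAdapted_transportRotation {n : ℕ} [NeZero n] (σ : ZMod n ≃ Fin n) :
    ∑ v : Fin n → ℤˣ with IsAdapted (transportRotation σ) v,
        (if v (σ 0) = -1 then ((∏ j, v j : ℤˣ) : ℤ) else 0) =
      ∑ w : ZMod n → ℤˣ with w 0 = -1,
        if IsCompatible w σ then ((∏ a, w a : ℤˣ) : ℤ) else 0 := by
  rw [← Finset.sum_filter, ← Finset.sum_filter, Finset.filter_filter, Finset.filter_filter]
  refine Finset.sum_nbij' (fun v => v ∘ σ) (fun w => w ∘ σ.symm) ?_ ?_ ?_ ?_ ?_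
  · intro v hv
    rw [Finset.mem_filter] at hv ⊢
    simpa [IsCompatible, Function.comp_assoc, and_comm] using hv
  · intro w hw
    rw [Finset.mem_filter] at hw ⊢
    simpa [IsCompatible, and_comm] using hw
  · intro v _
    simp [Function.comp_assoc]
  · intro w _
    simp [Function.comp_assoc]
  · intro v _
    congr 1
    exact (Equiv.prod_comp σ v).symm

theorem mainTheorem2 (n : ℕ) (hn : 1 ≤ n) :
    ∑ π ∈ unimodalCyclicPerms n, (-1 : ℤ) ^ des π = ArithmeticFunction.moebius n := by
  classical
  have : NeZero n := ⟨by omega⟩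
  -- Double count of triples: cyclic permutation, marked position, adapted word with -1 there.
  have key := sum_transportRotation fun (π : Equiv.Perm (Fin n)) i =>
    ∑ v : Fin n → ℤˣ with IsAdapted π v, (if v i = -1 then ((∏ j, v j : ℤˣ) : ℤ) else 0)
  simp only [sum_isAdapted_transportRotation] at key
  rw [Finset.sum_comm] at key
  have hl : ∀ w : ZMod n → ℤˣ, (∑ σ : ZMod n ≃ Fin n, if IsCompatible w σ then
      ((∏ a, w a : ℤˣ) : ℤ) else 0) = ((∏ a, w a : ℤˣ) : ℤ) * compatibleCount w := fun w => by
    rw [← Finset.sum_filter, Finset.sum_const, nsmul_eq_mul, mul_comm, compatibleCount]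
  simp only [hl, sum_prod_mul_compatibleCount] at key
  have hr : ∀ π : Equiv.Perm (Fin n), (∑ i, ∑ v : Fin n → ℤˣ with IsAdapted π v,
      (if v i = -1 then ((∏ j, v j : ℤˣ) : ℤ) else 0)) =
      if IsUnimodalWord (fun i => π i) then -(-1) ^ des π else 0 := fun π => by
    rw [Finset.sum_comm, sum_isAdapted]
  simp only [hr] at key
  rw [← Finset.sum_filter, Finset.filter_filter, Finset.sum_neg_distrib, neg_inj] at key
  rw [key, unimodalCyclicPerms]
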